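/- Let $d\ge 1$ and $\alpha\in(1,2)$, and let $\mu_\alpha$ be a non-degenerate symmetric $\alpha$-stable probability measure on $\mathbb R^d$ with associated L\'evy measure $\nu_\alpha$. Here: - $\nu_\alpha$ is a Borel measure with $\nu_\alpha(\{0\})=0$, $\int(1\wedge\|u\|^2)\,\nu_\alpha(du)<\infty$, and $\mu_\alpha$ is infinitely divisible with triplet $(b,0,\nu_\alpha)$ for some $b\in\mathbb R^d$, that is, for all $\xi\in\mathbb R^d$, $\hat\mu_\alpha(\xi)=\int e^{i\langle \xi;x\rangle}\mu_\alpha(dx)=e^{\Psi(\xi)}$ with $$\Psi(\xi)=i\langle \xi;b\rangle+\int_{\mathbb R^d}\left(e^{i\langle u;\xi\rangle}-1-i\langle u;\xi\rangle\mathbf 1_{\|u\|\le 1}\right)\nu_\alpha(du);$$ - $\alpha$-stable means that $\mu_\alpha$ is infinitely divisible as above and that for every $a>0$ there is $c\in\mathbb R^d$ with $\hat\mu_\alpha(\xi)^a:=e^{a\Psi(\xi)}=\hat\mu_\alpha(a^{1/\alpha}\xi)\,e^{i\langle c;\xi\rangle}$ for all $\xi\in\mathbb R^d$; - symmetric means $\mu_\alpha(-B)=\mu_\alpha(B)$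 for all Borel $B$, and non-degenerate means that the support of $\mu_\alpha$ is not contained in any translate of a proper linear subspace. For $R>0$ let $g_R(x)=x\,e^{-\|x\|^2/R^2}$, and for bounded $\mathcal C^1$ functions $f_1,f_2:\mathbb R^d\to\mathbb R^d$ with bounded derivative let $$\mathcal E^{\nu_\alpha}(f_1,f_2)=\int_{\mathbb R^d}\int_{\mathbb R^d}\langle f_1(x+u)-f_1(x);f_2(x+u)-f_2(x)\rangle\,\nu_\alpha(du)\,\mu_\alpha(dx).$$ Then for every $R>0$ the integrals defining $\mathcal E^{\nu_\alpha}(g_R,g_R)$ converge and $g_R\in L^2(\mu_\alpha)$, and $$\lim_{R\to+\infty}\left(\mathcal E^{\nu_\alpha}(g_R,g_R)-\|g_R\|^2_{L^2(\mu_\alpha)}\right)=0 .$$ Consequently $g_R$ is an approximate eigenvector of the form for the value $1$, in the sense that $\mathcal E^{\nu_\alpha}(g_R,g_R)/\|g_R\|^2_{L^2(\mu_\alpha)}\to 1$ as $R\to+\infty$. -/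

import Mathlib

open MeasureTheory Filter Topology
open scoped RealInnerProductSpace

noncomputable section

/-- The Euclidean space `ℝ^d`. -/
abbrev Rd (d : ℕ) : Type := EuclideanSpace ℝ (Fin d)

/-- A Borel measure `ν` on `ℝ^d` is a Lévy measure if `ν {0} = 0` and
`∫ min (1, ‖u‖²) ν(du) < ∞`. -/
def IsLevyMeasure {d : ℕ} (ν : Measure (Rd d)) : Prop :=
  ν {0} = 0 ∧ ∫⁻ u, ENNReal.ofReal (min 1 (‖u‖ ^ 2)) ∂ν < ⊤

/-- The Lévy-Khintchine exponent of the triplet `(b, 0, ν)` (no Gaussian part):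
`i ⟨ξ, b⟩ + ∫ (e^{i ⟨u, ξ⟩} - 1 - i ⟨u, ξ⟩ 1_{‖u‖ ≤ 1}) ν(du)`. -/
def levyExponent {d : ℕ} (b : Rd d) (ν : Measure (Rd d)) (ξ : Rd d) : ℂ :=
  Complex.I * ((⟪ξ, b⟫ : ℝ) : ℂ) +
    ∫ u : Rd d, (Complex.exp (Complex.I * ((⟪u, ξ⟫ : ℝ) : ℂ)) - 1
      - (if ‖u‖ ≤ 1 then Complex.I * ((⟪u, ξ⟫ : ℝ) : ℂ) else 0)) ∂ν

/-- `μ` is infinitely divisible with triplet `(b, 0, ν)`: its Fourier transform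
`ξ ↦ ∫ e^{i ⟨x, ξ⟩} μ(dx)` is the exponential of the Lévy-Khintchine exponent. -/
def HasLevyTriplet {d : ℕ} (μ : Measure (Rd d)) (b : Rd d) (ν : Measure (Rd d)) : Prop :=
  IsLevyMeasure ν ∧ ∀ ξ : Rd d, charFun μ ξ = Complex.exp (levyExponent b ν ξ)

/-- `ν` is the Lévy measure associated with the infinitely divisible law `μ`. -/
def IsLevyMeasureOf {d : ℕ} (ν μ : Measure (Rd d)) : Prop :=
  ∃ b : Rd d, HasLevyTriplet μ b ν

/-- `μ` is `α`-stable: it is infinitely divisible (without Gaussian part) and, for every `a > 0`,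
there is `c` such that `φ(ξ)^a = φ(a^{1/α} ξ) e^{i ⟨c, ξ⟩}` for all `ξ`, where `φ` is the Fourier
transform of `μ`. The power `φ(ξ)^a` of the Fourier transform of an infinitely divisible law is the
exponential of `a` times its Lévy-Khintchine exponent. -/
def IsAlphaStable {d : ℕ} (α : ℝ) (μ : Measure (Rd d)) : Prop :=
  ∃ (b : Rd d) (ν : Measure (Rd d)), HasLevyTriplet μ b ν ∧
    ∀ a : ℝ, 0 < a → ∃ c : Rd d, ∀ ξ : Rd d,
      Complex.exp ((a : ℂ) * levyExponent b ν ξ) =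
        charFun μ ((a ^ (1 / α) : ℝ) • ξ) * Complex.exp (Complex.I * ((⟪c, ξ⟫ : ℝ) : ℂ))

/-- `μ(-B) = μ(B)` for all Borel sets `B`. -/
def IsSymmetricMeasure {d : ℕ} (μ : Measure (Rd d)) : Prop :=
  ∀ B : Set (Rd d), MeasurableSet B → μ ((fun x => -x) ⁻¹' B) = μ B

/-- `μ` is degenerate if its support lies in a translate of a proper linear subspace. -/
def IsDegenerateMeasure {d : ℕ} (μ : Measure (Rd d)) : Prop :=
  ∃ (a : Rd d) (S : Submodule ℝ (Rd d)), S ≠ ⊤ ∧ μ.support ⊆ (fun x => a + x) '' (S : Set (Rd d))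

/-- The form `∫ ∫ ⟨f₁(x+u) - f₁(x), f₂(x+u) - f₂(x)⟩ ν(du) μ(dx)`. -/
def energyForm {d : ℕ} (ν μ : Measure (Rd d)) (f₁ f₂ : Rd d → Rd d) : ℝ :=
  ∫ x, ∫ u, ⟪f₁ (x + u) - f₁ x, f₂ (x + u) - f₂ x⟫ ∂ν ∂μ

/-- `g_R(x) = x exp(-‖x‖² / R²)`. -/
def gR {d : ℕ} (R : ℝ) (x : Rd d) : Rd d :=
  Real.exp (-(‖x‖ ^ 2 / R ^ 2)) • x

end

/-! Put r = 1/R, so that g_R(x) = R g_1(r x), and write s for the symbol ∫ (1 - cos⟨u, ξ⟩) ν(du).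
Both the energy and the squared norm are compared with ∫ ‖g_R‖² dν.

Norm (`exists_scaling_bounds`): f = ‖g_1‖² is an even Schwartz function with f(0) = 0, hence a
superposition of cosines with a rapidly decaying weight w. Symmetry gives ∫ cos⟨x, ξ⟩ dμ =
exp(-s(ξ)), and stability makes s homogeneous of degree α. With t = r^α, and up to the factor 2π in
the frequency, ∫ f(r x) dμ - f(0) is ∫ w (exp(-t s) - 1), while the ν-integral is the linear term -∫
w t s. The two differ by O(t²), so the norm differs from ∫ ‖g_R‖² dν by O(R^(2-2α)).

Energy (`HasTruncatedMomentBound.exists_abs_energyForm_sub_le`): replacing the increment at x by the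
increment at 0, which is g_R(u), costs at most R² ‖r x‖ min(1, ‖r u‖²) up to a constant. The
ν-integral of the minimum is O(r^α), and μ has a first moment because α > 1, so the error is
O(R^(1-α)).

Both errors vanish since α > 1. The quotient converges because the norms of g_R stay bounded away
from 0. -/

open scoped SchwartzMap FourierTransform

/-! ### Gaussian-type Schwartz functions -/

/-- Polynomials are dominated by the Gaussian weight. -/
theorem one_add_pow_mul_exp_neg_sq_le (N : ℕ) {r : ℝ} (hr : 0 ≤ r) :
    (1 + r) ^ N * Real.exp (-r ^ 2) ≤ N.factorial * Real.exp 2 := by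
  have h1 : (1 + r) ^ N ≤ N.factorial * Real.exp (1 + r) := by
    have := Real.pow_div_factorial_le_exp (1 + r) (by positivity) N
    rwa [div_le_iff₀ (by positivity), mul_comm] at this
  calc (1 + r) ^ N * Real.exp (-r ^ 2)
      ≤ (N.factorial * Real.exp (1 + r)) * Real.exp (-r ^ 2) := by gcongr
    _ = N.factorial * Real.exp (1 + r + -r ^ 2) := by rw [mul_assoc, ← Real.exp_add]
    _ ≤ N.factorial * Real.exp 2 := by
        gcongr
        nlinarith [sq_nonneg (r - 1 / 2)]

/-- Every derivative of `x ↦ exp (-‖x‖²)` decays faster than any power. -/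
theorem gaussian_decay {E : Type*} [NormedAddCommGroup E] [InnerProductSpace ℝ E] (k n : ℕ) :
    ∃ C : ℝ, ∀ x : E,
      ‖x‖ ^ k * ‖iteratedFDeriv ℝ n (fun x : E => Real.exp (-‖x‖ ^ 2)) x‖ ≤ C := by
  have hT : (fun x : E => -‖x‖ ^ 2).HasTemperateGrowth :=
    (Function.hasTemperateGrowth_norm_sq E).neg
  obtain ⟨m, C, hC, hb⟩ := hT.norm_iteratedFDeriv_le_uniform n
  refine ⟨n.factorial * (1 + C) ^ n * ((k + m * n).factorial * Real.exp 2), fun x => ?_⟩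
  -- The Faà di Bruno estimate wants a bound of the form D^i. Replacing C by 1 + C makes the base at
  -- least 1, so that it is below its own powers.
  have hD : ∀ i, 1 ≤ i → i ≤ n →
      ‖iteratedFDeriv ℝ i (fun x : E => -‖x‖ ^ 2) x‖ ≤ ((1 + C) * (1 + ‖x‖) ^ m) ^ i := by
    intro i hi hin
    have h1 : (1 : ℝ) ≤ (1 + C) * (1 + ‖x‖) ^ m :=
      one_le_mul_of_one_le_of_one_le (by linarith) (one_le_pow₀ (by linarith [norm_nonneg x]))
    calc _ ≤ C * (1 + ‖x‖) ^ m := hb i hin x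
      _ ≤ (1 + C) * (1 + ‖x‖) ^ m := by gcongr; linarith
      _ ≤ _ := le_self_pow₀ h1 (by omega)
  have hg : ∀ i, i ≤ n → ‖iteratedFDeriv ℝ i Real.exp (-‖x‖ ^ 2)‖ ≤ Real.exp (-‖x‖ ^ 2) := by
    intro i _
    rw [norm_iteratedFDeriv_eq_norm_iteratedDeriv, iteratedDeriv_eq_iterate, Real.iter_deriv_exp,
      Real.norm_of_nonneg (Real.exp_pos _).le]
  have key := norm_iteratedFDeriv_comp_le (n := n) (N := n) (g := Real.exp)
    (f := fun x : E => -‖x‖ ^ 2)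
    Real.contDiff_exp (hT.1.of_le (mod_cast le_top)) le_rfl x hg hD
  have hpow : ‖x‖ ^ k ≤ (1 + ‖x‖) ^ k := by gcongr; linarith
  calc ‖x‖ ^ k * ‖iteratedFDeriv ℝ n (fun x : E => Real.exp (-‖x‖ ^ 2)) x‖
      ≤ (1 + ‖x‖) ^ k * (n.factorial * Real.exp (-‖x‖ ^ 2) * ((1 + C) * (1 + ‖x‖) ^ m) ^ n) :=
        mul_le_mul hpow key (norm_nonneg _) (by positivity)
    _ = n.factorial * (1 + C) ^ n * ((1 + ‖x‖) ^ (k + m * n) * Real.exp (-‖x‖ ^ 2)) := by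
        rw [mul_pow, ← pow_mul, pow_add]; ring
    _ ≤ _ := mul_le_mul_of_nonneg_left (one_add_pow_mul_exp_neg_sq_le _ (norm_nonneg x))
        (by positivity)

/-- The function `x ↦ exp (-‖x‖²)` as a Schwartz function. -/
noncomputable def gaussianSchwartz (E : Type*) [NormedAddCommGroup E] [InnerProductSpace ℝ E] : 𝓢(E, ℝ) where
  toFun x := Real.exp (-‖x‖ ^ 2)
  smooth' := Real.contDiff_exp.comp (contDiff_norm_sq ℝ).neg
  decay' := gaussian_decay

theorem gaussianSchwartz_apply {E : Type*} [NormedAddCommGroup E] [InnerProductSpace ℝ E] (x : E) :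
    gaussianSchwartz E x = Real.exp (-‖x‖ ^ 2) := rfl

/-- The function `g₁ (x) = x exp (-‖x‖²)` is a Schwartz function. -/
theorem exists_schwartz_gR_one (d : ℕ) : ∃ f : 𝓢(Rd d, Rd d), ∀ x, f x = gR 1 x := by
  refine ⟨SchwartzMap.bilinLeftCLM (ContinuousLinearMap.lsmul ℝ ℝ (E := Rd d)).toContinuousLinearMap
    Function.HasTemperateGrowth.id' (gaussianSchwartz (Rd d)), fun x => ?_⟩
  rw [SchwartzMap.bilinLeftCLM_apply]
  simp [gR, gaussianSchwartz_apply]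

/-- The function `x ↦ ‖g₁ (x)‖²` is a Schwartz function. -/
theorem exists_schwartz_normSq_gR_one (d : ℕ) : ∃ f : 𝓢(Rd d, ℝ), ∀ x, f x = ‖gR 1 x‖ ^ 2 := by
  refine ⟨SchwartzMap.smulLeftCLM ℝ (fun x : Rd d => ‖x‖ ^ 2)
    (SchwartzMap.smulLeftCLM ℝ (gaussianSchwartz (Rd d)) (gaussianSchwartz (Rd d))), fun x => ?_⟩
  rw [SchwartzMap.smulLeftCLM_apply_apply (Function.hasTemperateGrowth_norm_sq _),
    SchwartzMap.smulLeftCLM_apply_apply (gaussianSchwartz (Rd d)).hasTemperateGrowth]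
  simp only [gR, gaussianSchwartz_apply, norm_smul, mul_pow, Real.norm_eq_abs, sq_abs, smul_eq_mul]
  rw [one_pow, div_one]; ring

/-! ### Cosine representation and increments of Schwartz functions -/

/-- An even Schwartz function is a superposition of cosines. -/
theorem exists_cos_representation {d : ℕ} (f : 𝓢(Rd d, ℝ)) (hf : ∀ x, f (-x) = f x) :
    ∃ w : Rd d → ℝ, Continuous w ∧ (∀ k : ℕ, Integrable fun ξ => ‖ξ‖ ^ k * ‖w ξ‖) ∧
      ∀ x, f x = ∫ ξ, w ξ * Real.cos ⟪x, (2 * Real.pi) • ξ⟫ := by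
  set F : 𝓢(Rd d, ℂ) := SchwartzMap.postcompCLM (𝕜 := ℝ) Complex.ofRealCLM f
  have hFx : ∀ x, F x = (f x : ℂ) := fun x => rfl
  set G : 𝓢(Rd d, ℂ) := 𝓕 F
  have hGint : ∀ k : ℕ, Integrable fun ξ => ‖ξ‖ ^ k * ‖G ξ‖ := fun k =>
    G.integrable_pow_mul volume k
  have hinv : ∀ x, (f x : ℂ) = ∫ ξ, Complex.exp ((⟪x, (2 * Real.pi) • ξ⟫ : ℝ) * Complex.I) * G ξ := by
    intro x
    have h1 : 𝓕⁻ G = F := FourierTransform.fourierInv_fourier_eq F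
    have h2 : 𝓕⁻ (G : Rd d → ℂ) x = F x := by rw [← SchwartzMap.fourierInv_coe, h1]
    rw [← hFx, ← h2, Real.fourierInv_eq']
    refine integral_congr_ae (ae_of_all _ fun ξ => ?_)
    simp only [smul_eq_mul]
    congr 3
    rw [real_inner_smul_right, real_inner_comm]
  have hint : ∀ x, Integrable fun ξ =>
      Complex.exp ((⟪x, (2 * Real.pi) • ξ⟫ : ℝ) * Complex.I) * G ξ := by
    intro x
    refine Integrable.mono' (G.integrable (μ := volume)).norm
      (by have := G.continuous; exact Continuous.aestronglyMeasurable (by fun_prop))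
      (ae_of_all _ fun ξ => ?_)
    rw [norm_mul, Complex.norm_exp_ofReal_mul_I, one_mul]
  have hint_re : ∀ x, Integrable fun ξ =>
      (Complex.exp ((⟪x, (2 * Real.pi) • ξ⟫ : ℝ) * Complex.I) * G ξ).re := fun x => (hint x).re
  have hre : ∀ x, f x = ∫ ξ, (Complex.exp ((⟪x, (2 * Real.pi) • ξ⟫ : ℝ) * Complex.I) * G ξ).re := by
    intro x
    have h := congrArg Complex.re (hinv x)
    rw [Complex.ofReal_re] at h
    rw [h]
    exact (integral_re (𝕜 := ℂ) (hint x)).symm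
  refine ⟨fun ξ => (G ξ).re, Complex.continuous_re.comp G.continuous, fun k => ?_, fun x => ?_⟩
  · refine Integrable.mono' (hGint k)
      (by have := G.continuous; exact Continuous.aestronglyMeasurable (by fun_prop))
      (ae_of_all _ fun ξ => ?_)
    rw [norm_mul, norm_pow, norm_norm, norm_norm]
    gcongr
    exact Complex.abs_re_le_norm _
  -- Averaging over x and -x cancels the sine part, leaving Re G as the weight.
  · have h2 : f x = (f x + f (-x)) / 2 := by rw [hf]; ring
    rw [h2, hre x, hre (-x), ← integral_add (hint_re x) (hint_re (-x)), ← integral_div]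
    refine integral_congr_ae (ae_of_all _ fun ξ => ?_)
    simp only [inner_neg_left, Complex.mul_re, Complex.exp_ofReal_mul_I_re,
      Complex.exp_ofReal_mul_I_im, Real.cos_neg, Real.sin_neg]
    ring

/-- A Schwartz function is bounded and Lipschitz, and its increments are Lipschitz with a constant
proportional to the increment. -/
theorem schwartz_increment_bounds {E F : Type*} [NormedAddCommGroup E] [NormedSpace ℝ E]
    [NormedAddCommGroup F] [NormedSpace ℝ F] (f : 𝓢(E, F)) :
    ∃ C : ℝ, 0 ≤ C ∧ (∀ x, ‖f x‖ ≤ C) ∧ (∀ x y, ‖f x - f y‖ ≤ C * ‖x - y‖) ∧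
      ∀ x y u, ‖(f (x + u) - f x) - (f (y + u) - f y)‖ ≤ C * ‖u‖ * ‖x - y‖ := by
  obtain ⟨C₀, hC₀, h0⟩ := f.decay 0 0
  obtain ⟨C₁, hC₁, h1⟩ := f.decay 0 1
  obtain ⟨C₂, hC₂, h2⟩ := f.decay 0 2
  simp only [pow_zero, one_mul, norm_iteratedFDeriv_zero] at h0
  simp only [pow_zero, one_mul, norm_iteratedFDeriv_one] at h1
  have h2' : ∀ x, ‖fderiv ℝ (fderiv ℝ f) x‖ ≤ C₂ := fun x => by
    have := h2 x
    rwa [pow_zero, one_mul, ← norm_iteratedFDeriv_fderiv, norm_iteratedFDeriv_one] at this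
  have hd : Differentiable ℝ (fderiv ℝ f) :=
    ((f.smooth 2).fderiv_right (m := 1) (by norm_num)).differentiable (by norm_num)
  have hlip : ∀ x y, ‖fderiv ℝ f x - fderiv ℝ f y‖ ≤ C₂ * ‖x - y‖ := fun x y =>
    convex_univ.norm_image_sub_le_of_norm_fderiv_le (fun z _ => hd z) (fun z _ => h2' z)
      (Set.mem_univ y) (Set.mem_univ x)
  refine ⟨C₀ + C₁ + C₂, by positivity, fun x => (h0 x).trans (by linarith), fun x y => ?_,
    fun x y u => ?_⟩
  · refine (convex_univ.norm_image_sub_le_of_norm_fderiv_le (fun z _ => f.differentiableAt)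
      (fun z _ => h1 z) (Set.mem_univ y) (Set.mem_univ x)).trans ?_
    gcongr; linarith
  -- For fixed u, the derivative of z ↦ f(z + u) - f(z) is an increment of Df, hence at most C₂‖u‖.
  · have hder : ∀ z, HasFDerivAt (fun z => f (z + u) - f z)
        (fderiv ℝ f (z + u) - fderiv ℝ f z) z := fun z =>
      ((hasFDerivAt_comp_add_right u).2 (f.differentiableAt.hasFDerivAt (x := z + u))).sub
        f.differentiableAt.hasFDerivAt
    refine (convex_univ.norm_image_sub_le_of_norm_hasFDerivWithin_le
      (fun z _ => (hder z).hasFDerivWithinAt) (C := C₂ * ‖u‖) (fun z _ => ?_)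
      (Set.mem_univ y) (Set.mem_univ x)).trans ?_
    · simpa using hlip (z + u) z
    · gcongr; linarith

/-! ### The symbol of a Lévy measure -/

/-- The real symbol `ξ ↦ ∫ (1 - cos ⟨u, ξ⟩) ν(du)` of a Lévy measure. -/
noncomputable def levySymbol {d : ℕ} (ν : Measure (Rd d)) (ξ : Rd d) : ℝ :=
  ∫ u, (1 - Real.cos ⟪u, ξ⟫) ∂ν

/-- Needed for Fubini. The weight min(1, ‖u‖²) turns ν into a finite measure and is positive off the
null set {0}, so ν is recovered by dividing by it. -/
theorem IsLevyMeasure.sFinite {d : ℕ} {ν : Measure (Rd d)} (h : IsLevyMeasure ν) : SFinite ν := by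
  set f : Rd d → ENNReal := fun u => ENNReal.ofReal (min 1 (‖u‖ ^ 2)) with hf
  have hfm : Measurable f := by fun_prop
  have hne : ∀ᵐ u ∂ν, f u ≠ 0 := by
    have : ∀ᵐ u ∂ν, u ≠ 0 := by
      rw [ae_iff]; simpa using h.1
    filter_upwards [this] with u hu
    have : 0 < min 1 (‖u‖ ^ 2) := lt_min one_pos (by positivity)
    exact (ENNReal.ofReal_pos.2 this).ne'
  have : IsFiniteMeasure (ν.withDensity f) := isFiniteMeasure_withDensity h.2.ne
  rw [← withDensity_inv_same hfm hne (ae_of_all _ fun u => ENNReal.ofReal_ne_top)]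
  infer_instance

theorem IsLevyMeasure.integrable_min {d : ℕ} {ν : Measure (Rd d)} (h : IsLevyMeasure ν) :
    Integrable (fun u => min 1 (‖u‖ ^ 2)) ν := by
  refine ⟨Continuous.aestronglyMeasurable (by fun_prop), ?_⟩
  rw [hasFiniteIntegral_iff_ofReal (ae_of_all _ fun u => by positivity)]
  exact h.2

theorem Real.one_sub_cos_nonneg (θ : ℝ) : 0 ≤ 1 - Real.cos θ := by
  linarith [Real.cos_le_one θ]

theorem one_sub_cos_inner_le {d : ℕ} (u ξ : Rd d) :
    1 - Real.cos ⟪u, ξ⟫ ≤ (2 + ‖ξ‖ ^ 2) * min 1 (‖u‖ ^ 2) := by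
  have h1 : 1 - Real.cos ⟪u, ξ⟫ ≤ 2 := by linarith [Real.neg_one_le_cos ⟪u, ξ⟫]
  have h2 : 1 - Real.cos ⟪u, ξ⟫ ≤ ‖u‖ ^ 2 * ‖ξ‖ ^ 2 := by
    have h3 := Real.one_sub_sq_div_two_le_cos (x := ⟪u, ξ⟫)
    have h4 : ⟪u, ξ⟫ ^ 2 ≤ (‖u‖ * ‖ξ‖) ^ 2 := by
      rw [← sq_abs]; gcongr; exact abs_real_inner_le_norm u ξ
    nlinarith [sq_nonneg ⟪u, ξ⟫]
  rcases le_total 1 (‖u‖ ^ 2) with h | h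
  · rw [min_eq_left h]; nlinarith [sq_nonneg ‖ξ‖]
  · rw [min_eq_right h]; nlinarith [sq_nonneg ‖ξ‖, sq_nonneg ‖u‖]

theorem IsLevyMeasure.integrable_one_sub_cos {d : ℕ} {ν : Measure (Rd d)} (h : IsLevyMeasure ν)
    (ξ : Rd d) : Integrable (fun u => 1 - Real.cos ⟪u, ξ⟫) ν := by
  refine Integrable.mono' (h.integrable_min.const_mul (2 + ‖ξ‖ ^ 2))
    (Continuous.aestronglyMeasurable (by fun_prop)) (ae_of_all _ fun u => ?_)
  rw [Real.norm_of_nonneg (Real.one_sub_cos_nonneg _)]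
  exact one_sub_cos_inner_le u ξ

theorem levySymbol_nonneg {d : ℕ} (ν : Measure (Rd d)) (ξ : Rd d) : 0 ≤ levySymbol ν ξ :=
  integral_nonneg fun _ => Real.one_sub_cos_nonneg _

theorem IsLevyMeasure.levySymbol_le {d : ℕ} {ν : Measure (Rd d)} (h : IsLevyMeasure ν) (ξ : Rd d) :
    levySymbol ν ξ ≤ (2 + ‖ξ‖ ^ 2) * ∫ u, min 1 (‖u‖ ^ 2) ∂ν := by
  rw [← integral_const_mul]
  exact integral_mono (h.integrable_one_sub_cos ξ) (h.integrable_min.const_mul _)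
    fun u => one_sub_cos_inner_le u ξ

theorem Complex.norm_exp_I_mul_sub_one_sub_le (θ : ℝ) :
    ‖Complex.exp (Complex.I * θ) - 1 - Complex.I * θ‖ ≤ 3 * θ ^ 2 := by
  have hθ : ‖Complex.I * (θ : ℂ)‖ = |θ| := by simp
  rcases le_total |θ| 1 with h | h
  · have := Complex.norm_exp_sub_one_sub_id_le (x := Complex.I * θ) (by rwa [hθ])
    rw [hθ, sq_abs] at this
    nlinarith [sq_nonneg θ]
  · have h1 : ‖Complex.exp (Complex.I * θ)‖ = 1 := by
      rw [mul_comm]; exact Complex.norm_exp_ofReal_mul_I θ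
    have h2 := norm_sub_le (Complex.exp (Complex.I * θ) - 1) (Complex.I * θ)
    have h3 := norm_sub_le (Complex.exp (Complex.I * θ)) 1
    rw [hθ] at h2
    rw [h1, norm_one] at h3
    nlinarith [sq_abs θ]

/-- The Lévy-Khintchine integrand is integrable. -/
theorem IsLevyMeasure.integrable_levyExponent {d : ℕ} {ν : Measure (Rd d)} (h : IsLevyMeasure ν)
    (ξ : Rd d) :
    Integrable (fun u : Rd d => Complex.exp (Complex.I * ((⟪u, ξ⟫ : ℝ) : ℂ)) - 1
      - (if ‖u‖ ≤ 1 then Complex.I * ((⟪u, ξ⟫ : ℝ) : ℂ) else 0)) ν := by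
  refine Integrable.mono' (h.integrable_min.const_mul (2 + 3 * ‖ξ‖ ^ 2)) ?_
    (ae_of_all _ fun u => ?_)
  · refine Measurable.aestronglyMeasurable (Measurable.sub (by fun_prop) ?_)
    exact Measurable.ite (measurableSet_le (by fun_prop) (by fun_prop)) (by fun_prop) (by fun_prop)
  · split_ifs with hu
    · have h4 : ⟪u, ξ⟫ ^ 2 ≤ (‖u‖ * ‖ξ‖) ^ 2 := by
        rw [← sq_abs]; gcongr; exact abs_real_inner_le_norm u ξ
      rw [min_eq_right (pow_le_one₀ (norm_nonneg u) hu)]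
      have := Complex.norm_exp_I_mul_sub_one_sub_le ⟪u, ξ⟫
      nlinarith [sq_nonneg ‖u‖]
    · rw [sub_zero, min_eq_left (one_le_pow₀ (not_le.1 hu).le)]
      have h1 : ‖Complex.exp (Complex.I * ((⟪u, ξ⟫ : ℝ) : ℂ))‖ = 1 := by
        rw [mul_comm]; exact Complex.norm_exp_ofReal_mul_I _
      have h3 := norm_sub_le (Complex.exp (Complex.I * ((⟪u, ξ⟫ : ℝ) : ℂ))) 1
      rw [h1, norm_one] at h3
      nlinarith [sq_nonneg ‖ξ‖]

/-- The drift and the compensator are purely imaginary, so only the cosine survives. Hence the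
modulus of the Fourier transform determines the symbol. -/
theorem IsLevyMeasure.levyExponent_re {d : ℕ} {ν : Measure (Rd d)} (h : IsLevyMeasure ν)
    (b ξ : Rd d) : (levyExponent b ν ξ).re = -levySymbol ν ξ := by
  rw [levyExponent, Complex.add_re, levySymbol, ← integral_neg]
  have h1 : (Complex.I * ((⟪ξ, b⟫ : ℝ) : ℂ)).re = 0 := by simp
  rw [h1, zero_add]
  refine (integral_re (𝕜 := ℂ) (h.integrable_levyExponent ξ)).symm.trans ?_
  refine integral_congr_ae (ae_of_all _ fun u => ?_)
  have h2 : (Complex.exp (Complex.I * ((⟪u, ξ⟫ : ℝ) : ℂ))).re = Real.cos ⟪u, ξ⟫ := by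
    rw [mul_comm]; exact Complex.exp_ofReal_mul_I_re _
  simp only [RCLike.re_to_complex, Complex.sub_re, h2]
  split_ifs <;> simp

theorem HasLevyTriplet.norm_charFun {d : ℕ} {μ ν : Measure (Rd d)} {b : Rd d}
    (h : HasLevyTriplet μ b ν) (ξ : Rd d) : ‖charFun μ ξ‖ = Real.exp (-levySymbol ν ξ) := by
  rw [h.2, Complex.norm_exp, h.1.levyExponent_re]

/-- The symbol of a stable law is positively homogeneous. -/
theorem IsAlphaStable.levySymbol_smul {d : ℕ} {α : ℝ} (hα : α ≠ 0) {μ ν : Measure (Rd d)}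
    (hstable : IsAlphaStable α μ) (hν : IsLevyMeasureOf ν μ) {r : ℝ} (hr : 0 < r) (ξ : Rd d) :
    levySymbol ν (r • ξ) = r ^ α * levySymbol ν ξ := by
  obtain ⟨b, ν', h', hst⟩ := hstable
  obtain ⟨b₀, h⟩ := hν
  -- The triplet witnessing stability need not be the given one, but both symbols are read off from
  -- the same modulus.
  have heq : ∀ ξ, levySymbol ν' ξ = levySymbol ν ξ := fun ξ => by
    have := h'.norm_charFun ξ
    rw [h.norm_charFun] at this
    linarith [Real.exp_injective this]
  -- The choice a = r^α makes a^(1/α) = r. Taking norms then removes the factor containing c.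
  obtain ⟨c, hc⟩ := hst (r ^ α) (Real.rpow_pos_of_pos hr α)
  have h1 := congrArg norm (hc ξ)
  have h2 : ‖Complex.exp (Complex.I * ((⟪c, ξ⟫ : ℝ) : ℂ))‖ = 1 := by
    rw [mul_comm]; exact Complex.norm_exp_ofReal_mul_I _
  rw [norm_mul, h2, mul_one, Complex.norm_exp, h.norm_charFun, Complex.re_ofReal_mul,
    h'.1.levyExponent_re, ← Real.rpow_mul hr.le, mul_one_div_cancel hα, Real.rpow_one, heq] at h1
  linarith [Real.exp_injective h1]

theorem IsSymmetricMeasure.map_neg {d : ℕ} {μ : Measure (Rd d)} (h : IsSymmetricMeasure μ) :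
    μ.map (fun x => -x) = μ := by
  ext B hB
  rw [Measure.map_apply measurable_neg hB, h B hB]

theorem integral_cos_eq_charFun_re {d : ℕ} (μ : Measure (Rd d)) [IsProbabilityMeasure μ]
    (ξ : Rd d) : ∫ x, Real.cos ⟪x, ξ⟫ ∂μ = (charFun μ ξ).re := by
  have hint : Integrable (fun x : Rd d => Complex.exp (⟪x, ξ⟫ * Complex.I)) μ := by
    refine Integrable.of_bound (Continuous.aestronglyMeasurable (by fun_prop)) 1
      (ae_of_all _ fun x => ?_)
    rw [Complex.norm_exp_ofReal_mul_I]
  rw [charFun_apply]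
  refine Eq.trans ?_ (integral_re (𝕜 := ℂ) hint)
  refine integral_congr_ae (ae_of_all _ fun x => ?_)
  exact (Complex.exp_ofReal_mul_I_re _).symm

/-- The Fourier transform of a symmetric infinitely divisible law without Gaussian part is the
exponential of minus its symbol. -/
theorem HasLevyTriplet.integral_cos {d : ℕ} {μ ν : Measure (Rd d)} [IsProbabilityMeasure μ]
    {b : Rd d} (h : HasLevyTriplet μ b ν) (hsymm : IsSymmetricMeasure μ) (ξ : Rd d) :
    ∫ x, Real.cos ⟪x, ξ⟫ ∂μ = Real.exp (-levySymbol ν ξ) := by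
  have him : ∀ ξ, (charFun μ ξ).im = 0 := fun ξ => by
    have h1 : charFun μ (-ξ) = charFun μ ξ := by
      conv_rhs => rw [← hsymm.map_neg]
      have := charFun_map_smul (μ := μ) (-1) ξ
      simp only [neg_smul, one_smul] at this
      exact this.symm
    rw [charFun_neg] at h1
    exact Complex.conj_eq_iff_im.1 h1
  have hnorm : ∀ ξ, ‖charFun μ ξ‖ = |(charFun μ ξ).re| := fun ξ =>
    (Complex.abs_re_eq_norm.2 (him ξ)).symm
  have hcont : Continuous fun ξ => (charFun μ ξ).re :=
    Complex.continuous_re.comp continuous_charFun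
  have hne : ∀ ξ, (charFun μ ξ).re ≠ 0 := fun ξ h0 => by
    have := hnorm ξ
    rw [h.norm_charFun, h0, abs_zero] at this
    exact (Real.exp_pos _).ne' this
  -- The transform is real, continuous, never zero and equal to 1 at 0, so it cannot change sign.
  have hpos : 0 < (charFun μ ξ).re := by
    by_contra hn
    have h0 : (0 : ℝ) ∈ Set.Icc (charFun μ ξ).re (charFun μ (0 : Rd d)).re := by
      refine ⟨not_lt.1 hn, ?_⟩
      simp [charFun_zero]
    obtain ⟨η, hη⟩ := mem_range_of_exists_le_of_exists_ge hcont ⟨ξ, h0.1⟩ ⟨0, h0.2⟩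
    exact hne η hη
  rw [integral_cos_eq_charFun_re, ← abs_of_pos hpos, ← hnorm, h.norm_charFun]

theorem HasLevyTriplet.continuous_levySymbol {d : ℕ} {μ ν : Measure (Rd d)}
    [IsProbabilityMeasure μ] {b : Rd d} (h : HasLevyTriplet μ b ν) :
    Continuous (levySymbol ν) := by
  have h1 : levySymbol ν = fun ξ => -Real.log ‖charFun μ ξ‖ := by
    ext ξ; rw [h.norm_charFun, Real.log_exp, neg_neg]
  rw [h1]
  refine (Continuous.log continuous_charFun.norm fun ξ => ?_).neg
  rw [h.norm_charFun]; exact (Real.exp_pos _).ne'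

/-! ### Small-scale expansion under μ and ν -/

theorem abs_exp_neg_sub_one_le {y : ℝ} (hy : 0 ≤ y) : |Real.exp (-y) - 1| ≤ y := by
  rw [abs_le]
  have := Real.add_one_le_exp (-y)
  have h2 : Real.exp (-y) ≤ 1 := Real.exp_le_one_iff.2 (by linarith)
  constructor <;> linarith

theorem abs_exp_neg_sub_one_add_le {y : ℝ} (hy : 0 ≤ y) : |Real.exp (-y) - 1 + y| ≤ y ^ 2 := by
  have h1 := Real.add_one_le_exp (-y)
  have h2 : Real.exp (-y) * Real.exp y = 1 := by rw [← Real.exp_add]; simp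
  have h3 := Real.add_one_le_exp y
  have h4 : Real.exp (-y) * (1 + y) ≤ 1 := by
    nlinarith [Real.exp_pos (-y)]
  rw [abs_of_nonneg (by linarith)]
  -- The right side is 1 + y³.
  have h5 : Real.exp (-y) * (1 + y) ≤ (1 - y + y ^ 2) * (1 + y) := by
    nlinarith [pow_nonneg hy 3]
  linarith [le_of_mul_le_mul_right h5 (by linarith)]

/-- Short-time expansions of an even Schwartz function under a scaled symmetric stable law: up to
an error of second order in `R ^ (-α)`, the expectation is given by the Lévy measure. -/
theorem exists_scaling_bounds {d : ℕ} {α : ℝ} {μ ν : Measure (Rd d)} [IsProbabilityMeasure μ]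
    [SFinite ν] (hν : IsLevyMeasure ν) (hcont : Continuous (levySymbol ν))
    (hcos : ∀ ξ, ∫ x, Real.cos ⟪x, ξ⟫ ∂μ = Real.exp (-levySymbol ν ξ))
    (hom : ∀ r : ℝ, 0 < r → ∀ ξ, levySymbol ν (r • ξ) = r ^ α * levySymbol ν ξ)
    (f : 𝓢(Rd d, ℝ)) (hf : ∀ x, f (-x) = f x) :
    ∃ C : ℝ, 0 ≤ C ∧ ∀ r : ℝ, 0 < r →
      Integrable (fun u => f (r • u) - f 0) ν ∧
      |∫ u, (f (r • u) - f 0) ∂ν| ≤ C * r ^ α ∧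
      |∫ x, f (r • x) ∂μ - f 0| ≤ C * r ^ α ∧
      |(∫ x, f (r • x) ∂μ - f 0) - ∫ u, (f (r • u) - f 0) ∂ν| ≤ C * (r ^ α) ^ 2 := by
  obtain ⟨w, hwc, hwi, hrep⟩ := exists_cos_representation f hf
  set s : Rd d → ℝ := fun ξ => levySymbol ν ((2 * Real.pi) • ξ)
  have hs0 : ∀ ξ, 0 ≤ s ξ := fun ξ => levySymbol_nonneg _ _
  have hsc : Continuous s := by fun_prop
  have hw0 : Integrable w := by
    have := hwi 0
    simp only [pow_zero, one_mul] at this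
    exact (integrable_norm_iff hwc.aestronglyMeasurable).1 this
  have hw2 : ∀ a b : ℝ, Integrable fun ξ => ‖w ξ‖ * (a + b * ‖ξ‖ ^ 2) := fun a b => by
    refine ((hw0.norm.const_mul a).add ((hwi 2).const_mul b)).congr (ae_of_all _ fun ξ => ?_)
    simp only [Pi.add_apply]; ring
  set K := ∫ u, min 1 (‖u‖ ^ 2) ∂ν
  have hK0 : 0 ≤ K := integral_nonneg fun u => by positivity
  have hsle : ∀ ξ, s ξ ≤ (2 * K) + ((2 * Real.pi) ^ 2 * K) * ‖ξ‖ ^ 2 := fun ξ => by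
    refine (hν.levySymbol_le _).trans (le_of_eq ?_)
    rw [norm_smul, mul_pow, Real.norm_eq_abs, sq_abs]; ring
  have hws : Integrable fun ξ => ‖w ξ‖ * s ξ := by
    refine Integrable.mono' (hw2 (2 * K) ((2 * Real.pi) ^ 2 * K))
      (Continuous.aestronglyMeasurable (by fun_prop))
      (ae_of_all _ fun ξ => ?_)
    rw [norm_mul, norm_norm, Real.norm_of_nonneg (hs0 ξ)]
    exact mul_le_mul_of_nonneg_left (hsle ξ) (norm_nonneg _)
  -- The symbol grows at most quadratically, so its square is controlled by the fourth moment of w.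
  have hws2 : Integrable fun ξ => ‖w ξ‖ * s ξ ^ 2 := by
    have h4 : Integrable fun ξ => ‖w ξ‖ * ((2 * K) + ((2 * Real.pi) ^ 2 * K) * ‖ξ‖ ^ 2) ^ 2 := by
      refine ((hw2 ((2 * K) ^ 2) (2 * (2 * K) * ((2 * Real.pi) ^ 2 * K))).add
        ((hwi 4).const_mul (((2 * Real.pi) ^ 2 * K) ^ 2))).congr (ae_of_all _ fun ξ => ?_)
      simp only [Pi.add_apply]; ring
    refine Integrable.mono' h4 (Continuous.aestronglyMeasurable (by fun_prop))
      (ae_of_all _ fun ξ => ?_)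
    rw [norm_mul, norm_norm, Real.norm_of_nonneg (sq_nonneg _)]
    have := hsle ξ
    have := hs0 ξ
    gcongr
  have hf0 : f 0 = ∫ ξ, w ξ := by rw [hrep 0]; simp
  have hwcos : ∀ x, Integrable fun ξ => w ξ * Real.cos ⟪x, (2 * Real.pi) • ξ⟫ := fun x => by
    refine Integrable.mono' hw0.norm (Continuous.aestronglyMeasurable (by fun_prop))
      (ae_of_all _ fun ξ => ?_)
    rw [norm_mul]
    exact mul_le_of_le_one_right (norm_nonneg _) (Real.abs_cos_le_one _)
  -- The first summand serves the two first-order bounds, the second the second-order bound.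
  refine ⟨(∫ ξ, ‖w ξ‖ * s ξ) + ∫ ξ, ‖w ξ‖ * s ξ ^ 2, ?_, fun r hr => ?_⟩
  · exact add_nonneg (integral_nonneg fun ξ => mul_nonneg (norm_nonneg _) (hs0 ξ))
      (integral_nonneg fun ξ => mul_nonneg (norm_nonneg _) (sq_nonneg _))
  set t := r ^ α with ht
  have ht0 : 0 < t := Real.rpow_pos_of_pos hr α
  have hswap : ∀ (u ξ : Rd d), ⟪r • u, (2 * Real.pi) • ξ⟫ = ⟪u, r • (2 * Real.pi) • ξ⟫ :=
    fun u ξ => by rw [real_inner_smul_left, real_inner_smul_right (r := r)]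
  have hsr : ∀ ξ, levySymbol ν (r • (2 * Real.pi) • ξ) = t * s ξ := fun ξ => hom r hr _
  have hdiff : ∀ u, f (r • u) - f 0 =
      ∫ ξ, w ξ * (Real.cos ⟪u, r • (2 * Real.pi) • ξ⟫ - 1) := fun u => by
    rw [hrep (r • u), hf0, ← integral_sub (hwcos _) hw0]
    refine integral_congr_ae (ae_of_all _ fun ξ => ?_)
    simp only [hswap]; ring
  have hprodν : Integrable (fun p : Rd d × Rd d =>
      w p.2 * (Real.cos ⟪p.1, r • (2 * Real.pi) • p.2⟫ - 1)) (ν.prod volume) := by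
    refine Integrable.mono' (hν.integrable_min.mul_prod (hw2 2 ((r * (2 * Real.pi)) ^ 2)))
      (Continuous.aestronglyMeasurable (by fun_prop)) (ae_of_all _ fun p => ?_)
    rw [norm_mul, norm_sub_rev, Real.norm_of_nonneg (Real.one_sub_cos_nonneg _)]
    have h1 := one_sub_cos_inner_le p.1 (r • (2 * Real.pi) • p.2)
    rw [smul_smul, norm_smul, mul_pow, Real.norm_eq_abs, sq_abs, ← smul_smul] at h1
    calc _ ≤ ‖w p.2‖ * _ := mul_le_mul_of_nonneg_left h1 (norm_nonneg _)
      _ = _ := by ring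
  have hintν : Integrable (fun u => f (r • u) - f 0) ν :=
    hprodν.integral_prod_left.congr (ae_of_all _ fun u => (hdiff u).symm)
  have hB : ∫ u, (f (r • u) - f 0) ∂ν = ∫ ξ, -(t * (w ξ * s ξ)) := by
    simp_rw [hdiff]
    rw [integral_integral_swap hprodν]
    refine integral_congr_ae (ae_of_all _ fun ξ => ?_)
    simp only
    rw [integral_const_mul]
    have : ∫ u, (Real.cos ⟪u, r • (2 * Real.pi) • ξ⟫ - 1) ∂ν = -(t * s ξ) := by
      rw [← hsr, levySymbol, ← integral_neg]; simp
    rw [this]; ring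
  have hprodμ : Integrable (fun p : Rd d × Rd d =>
      w p.2 * Real.cos ⟪p.1, r • (2 * Real.pi) • p.2⟫) (μ.prod volume) := by
    refine Integrable.mono' ((integrable_const (1 : ℝ)).mul_prod hw0.norm)
      (Continuous.aestronglyMeasurable (by fun_prop)) (ae_of_all _ fun p => ?_)
    rw [norm_mul, one_mul]
    exact mul_le_of_le_one_right (norm_nonneg _) (Real.abs_cos_le_one _)
  have hA' : ∫ x, f (r • x) ∂μ = ∫ ξ, w ξ * Real.exp (-(t * s ξ)) := by
    simp_rw [hrep, hswap]
    rw [integral_integral_swap hprodμ]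
    refine integral_congr_ae (ae_of_all _ fun ξ => ?_)
    simp only
    rw [integral_const_mul, hcos, hsr]
  have hwexp : Integrable fun ξ => w ξ * Real.exp (-(t * s ξ)) := by
    refine Integrable.mono' hw0.norm (Continuous.aestronglyMeasurable (by fun_prop))
      (ae_of_all _ fun ξ => ?_)
    rw [norm_mul, Real.norm_of_nonneg (Real.exp_pos _).le]
    exact mul_le_of_le_one_right (norm_nonneg _)
      (Real.exp_le_one_iff.2 (neg_nonpos.2 (mul_nonneg ht0.le (hs0 ξ))))
  have hA : ∫ x, f (r • x) ∂μ - f 0 = ∫ ξ, w ξ * (Real.exp (-(t * s ξ)) - 1) := by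
    rw [hA', hf0, ← integral_sub hwexp hw0]
    refine integral_congr_ae (ae_of_all _ fun ξ => ?_)
    simp only; ring
  have hw_s : Integrable fun ξ => -(t * (w ξ * s ξ)) := by
    refine (Integrable.const_mul ?_ t).neg
    refine Integrable.mono' hws (Continuous.aestronglyMeasurable (by fun_prop))
      (ae_of_all _ fun ξ => ?_)
    rw [norm_mul, Real.norm_of_nonneg (hs0 ξ)]
  have hAB : (∫ x, f (r • x) ∂μ - f 0) - ∫ u, (f (r • u) - f 0) ∂ν =
      ∫ ξ, w ξ * (Real.exp (-(t * s ξ)) - 1 + t * s ξ) := by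
    have h1 : Integrable fun ξ => w ξ * (Real.exp (-(t * s ξ)) - 1) :=
      (hwexp.sub hw0).congr (ae_of_all _ fun ξ => by simp only [Pi.sub_apply]; ring)
    rw [hA, hB, ← integral_sub h1 hw_s]
    refine integral_congr_ae (ae_of_all _ fun ξ => ?_)
    simp only; ring
  have hI1 : 0 ≤ ∫ ξ, ‖w ξ‖ * s ξ := integral_nonneg fun ξ => mul_nonneg (norm_nonneg _) (hs0 ξ)
  have hI2 : 0 ≤ ∫ ξ, ‖w ξ‖ * s ξ ^ 2 :=
    integral_nonneg fun ξ => mul_nonneg (norm_nonneg _) (sq_nonneg _)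
  have hfirst : ∀ v : Rd d → ℝ, (∀ ξ, |v ξ| ≤ (‖w ξ‖ * s ξ) * t) →
      |∫ ξ, v ξ| ≤ ((∫ ξ, ‖w ξ‖ * s ξ) + ∫ ξ, ‖w ξ‖ * s ξ ^ 2) * t := fun v hv => by
    have := norm_integral_le_of_norm_le (hws.mul_const t) (f := v)
      (ae_of_all _ hv)
    rw [integral_mul_const, Real.norm_eq_abs] at this
    nlinarith
  refine ⟨hintν, ?_, ?_, ?_⟩
  · rw [hB]
    refine hfirst _ fun ξ => ?_
    rw [abs_neg, abs_mul, abs_mul, abs_of_pos ht0, abs_of_nonneg (hs0 ξ), Real.norm_eq_abs]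
    exact le_of_eq (by ring)
  · rw [hA]
    refine hfirst _ fun ξ => ?_
    rw [abs_mul, Real.norm_eq_abs, mul_assoc, mul_comm (s ξ)]
    exact mul_le_mul_of_nonneg_left (abs_exp_neg_sub_one_le (mul_nonneg ht0.le (hs0 ξ)))
      (abs_nonneg _)
  · rw [hAB]
    have := norm_integral_le_of_norm_le (hws2.mul_const (t ^ 2))
      (f := fun ξ => w ξ * (Real.exp (-(t * s ξ)) - 1 + t * s ξ)) (ae_of_all _ fun ξ => by
        rw [norm_mul, mul_assoc, mul_comm (s ξ ^ 2), ← mul_pow]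
        exact mul_le_mul_of_nonneg_left (abs_exp_neg_sub_one_add_le (mul_nonneg ht0.le (hs0 ξ)))
          (norm_nonneg _))
    rw [integral_mul_const, Real.norm_eq_abs] at this
    nlinarith [sq_nonneg t]

/-! ### Truncated moments and the first moment -/

theorem min_one_le_two_mul_one_sub_exp_neg {s : ℝ} (hs : 0 ≤ s) :
    min 1 s ≤ 2 * (1 - Real.exp (-s)) := by
  have h1 := Real.add_one_le_exp s
  have h2 : Real.exp (-s) * Real.exp s = 1 := by rw [← Real.exp_add]; simp
  have h3 : Real.exp (-s) * (1 + s) ≤ 1 := by nlinarith [Real.exp_pos (-s)]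
  refine le_of_mul_le_mul_right ?_ (show 0 < 1 + s by linarith)
  rcases le_total 1 s with h | h
  · rw [min_eq_left h]; nlinarith
  · rw [min_eq_right h]; nlinarith

/-- The measure `ν` has truncated second moments of order `r ^ α` at scale `r⁻¹`. -/
def HasTruncatedMomentBound {d : ℕ} (α C : ℝ) (ν : Measure (Rd d)) : Prop :=
  ∀ r : ℝ, 0 < r → Integrable (fun u => min 1 (‖r • u‖ ^ 2)) ν ∧
    ∫ u, min 1 (‖r • u‖ ^ 2) ∂ν ≤ C * r ^ α

/-- The truncated square is at most 2(1 - exp(-‖x‖²)), so the first-order bounds for the Gaussian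
apply to μ and ν alike. -/
theorem exists_hasTruncatedMomentBound {d : ℕ} {α : ℝ} {μ ν : Measure (Rd d)}
    [IsProbabilityMeasure μ] [SFinite ν] (hν : IsLevyMeasure ν) (hcont : Continuous (levySymbol ν))
    (hcos : ∀ ξ, ∫ x, Real.cos ⟪x, ξ⟫ ∂μ = Real.exp (-levySymbol ν ξ))
    (hom : ∀ r : ℝ, 0 < r → ∀ ξ, levySymbol ν (r • ξ) = r ^ α * levySymbol ν ξ) :
    ∃ C : ℝ, 0 ≤ C ∧ HasTruncatedMomentBound α C μ ∧ HasTruncatedMomentBound α C ν := by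
  obtain ⟨C, hC, h⟩ := exists_scaling_bounds hν hcont hcos hom (gaussianSchwartz (Rd d))
    (fun x => by simp only [gaussianSchwartz_apply, norm_neg])
  have hg0 : gaussianSchwartz (Rd d) 0 = 1 := by simp [gaussianSchwartz_apply]
  have hle : ∀ x : Rd d, min 1 (‖x‖ ^ 2) ≤
      -2 * (gaussianSchwartz (Rd d) x - gaussianSchwartz (Rd d) 0) := fun x => by
    rw [hg0, gaussianSchwartz_apply]
    linarith [min_one_le_two_mul_one_sub_exp_neg (sq_nonneg ‖x‖)]
  have key : ∀ (ρ : Measure (Rd d)) (r : ℝ),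
      Integrable (fun u => gaussianSchwartz (Rd d) (r • u) - gaussianSchwartz (Rd d) 0) ρ →
      |∫ u, (gaussianSchwartz (Rd d) (r • u) - gaussianSchwartz (Rd d) 0) ∂ρ| ≤ C * r ^ α →
      Integrable (fun u => min 1 (‖r • u‖ ^ 2)) ρ ∧
        ∫ u, min 1 (‖r • u‖ ^ 2) ∂ρ ≤ 2 * C * r ^ α := by
    intro ρ r hi hb
    have hint : Integrable (fun u => min 1 (‖r • u‖ ^ 2)) ρ := by
      refine Integrable.mono' (hi.const_mul (-2)) (Continuous.aestronglyMeasurable (by fun_prop))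
        (ae_of_all _ fun u => ?_)
      rw [Real.norm_of_nonneg (by positivity)]
      exact hle _
    refine ⟨hint, ?_⟩
    have := integral_mono hint (hi.const_mul (-2)) fun u => hle (r • u)
    rw [integral_const_mul] at this
    have h2 := neg_abs_le
      (∫ u, (gaussianSchwartz (Rd d) (r • u) - gaussianSchwartz (Rd d) 0) ∂ρ)
    linarith
  refine ⟨2 * C, by positivity, fun r hr => ?_, fun r hr => ?_⟩
  · have hi : Integrable (fun x => gaussianSchwartz (Rd d) (r • x)) μ := by
      refine Integrable.of_bound (Continuous.aestronglyMeasurable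
        ((gaussianSchwartz (Rd d)).continuous.comp (continuous_const_smul r))) 1
        (ae_of_all _ fun x => ?_)
      rw [gaussianSchwartz_apply, Real.norm_of_nonneg (Real.exp_pos _).le]
      exact Real.exp_le_one_iff.2 (by simp)
    refine key μ r (hi.sub (integrable_const _)) ?_
    rw [integral_sub hi (integrable_const _), integral_const, probReal_univ, one_smul]
    exact (h r hr).2.2.1
  · exact key ν r (h r hr).1 (h r hr).2.1

/-- A truncated moment bound of order `α > 1` gives a first moment. -/
theorem HasTruncatedMomentBound.integrable_norm {d : ℕ} {α C : ℝ} (hα : 1 < α) {μ : Measure (Rd d)}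
    [IsProbabilityMeasure μ] (h : HasTruncatedMomentBound α C μ) :
    Integrable (fun x => ‖x‖) μ := by
  refine ⟨continuous_norm.aestronglyMeasurable, ?_⟩
  rw [hasFiniteIntegral_iff_ofReal (ae_of_all _ fun x => norm_nonneg x),
    lintegral_eq_lintegral_meas_le μ (ae_of_all _ fun x => norm_nonneg x)
      continuous_norm.aemeasurable]
  -- Markov's inequality at scale r = 1/t; the resulting tail t^(-α) is integrable at infinity
  -- because α > 1.
  have htail : ∀ t ∈ Set.Ioi (1 : ℝ), μ {x | t ≤ ‖x‖} ≤ ENNReal.ofReal (C * t ^ (-α)) := by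
    intro t ht
    have ht0 : (0 : ℝ) < t := lt_trans one_pos ht
    obtain ⟨hi, hb⟩ := h t⁻¹ (inv_pos.2 ht0)
    have h1 := mul_meas_ge_le_integral_of_nonneg
      (ae_of_all _ fun x : Rd d => show 0 ≤ min 1 (‖t⁻¹ • x‖ ^ 2) by positivity) hi 1
    rw [one_mul] at h1
    rw [Real.inv_rpow ht0.le, ← Real.rpow_neg ht0.le] at hb
    rw [← ofReal_measureReal]
    refine ENNReal.ofReal_le_ofReal ((measureReal_mono fun x hx => ?_).trans (h1.trans hb))
    simp only [Set.mem_ofPred_eq] at hx ⊢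
    refine le_min le_rfl (one_le_pow₀ ?_)
    rw [norm_smul, norm_inv, Real.norm_of_nonneg ht0.le, ← div_eq_inv_mul, one_le_div ht0]
    exact hx
  rw [← Set.Ioc_union_Ioi_eq_Ioi (zero_le_one (α := ℝ))]
  refine (lintegral_union_le _ _ _).trans_lt (ENNReal.add_lt_top.2 ⟨?_, ?_⟩)
  · refine (lintegral_mono (g := fun _ => 1) fun t => prob_le_one).trans_lt ?_
    simp
  · refine (setLIntegral_mono (by fun_prop) htail).trans_lt ?_
    exact (((integrableOn_Ioi_rpow_of_lt (by linarith) one_pos).const_mul C).lintegral_lt_top)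

/-! ### Increments of g_R and comparison of the energy -/

theorem gR_eq_smul {d : ℕ} {R : ℝ} (hR : 0 < R) (x : Rd d) : gR R x = R • gR 1 (R⁻¹ • x) := by
  rw [gR, gR, smul_comm, smul_inv_smul₀ hR.ne', norm_smul, norm_inv, Real.norm_of_nonneg hR.le]
  congr 3
  field_simp

theorem gR_zero {d : ℕ} (R : ℝ) : gR R (0 : Rd d) = 0 := by simp [gR]

theorem continuous_gR {d : ℕ} (R : ℝ) : Continuous (gR R : Rd d → Rd d) := by
  unfold gR; fun_prop

theorem min_one_sq_bound {a b r : ℝ} (ha : 0 ≤ a) (hb : 0 ≤ b) (h1 : a ≤ 1 ∧ b ≤ 1)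
    (h2 : a ≤ r ∧ b ≤ r) : a * b ≤ min 1 (r ^ 2) := by
  refine le_min (by nlinarith [h1.1, h1.2]) ?_
  rw [sq]
  exact mul_le_mul h2.1 h2.2 hb (ha.trans h2.1)

/-- Bounds for the squared increments of `g_R` in terms of the scaled variables. -/
theorem exists_gR_increment_bounds (d : ℕ) : ∃ C : ℝ, 0 ≤ C ∧ ∀ R : ℝ, 0 < R → ∀ x u : Rd d,
    ‖gR R x‖ ≤ R * C ∧
    ‖gR R (x + u) - gR R x‖ ^ 2 ≤ R ^ 2 * (C * min 1 (‖R⁻¹ • u‖ ^ 2)) ∧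
    |‖gR R (x + u) - gR R x‖ ^ 2 - ‖gR R u‖ ^ 2| ≤
      R ^ 2 * (C * ‖R⁻¹ • x‖ * min 1 (‖R⁻¹ • u‖ ^ 2)) := by
  obtain ⟨f, hf⟩ := exists_schwartz_gR_one d
  obtain ⟨C, hC, hb, hl, hll⟩ := schwartz_increment_bounds f
  simp only [hf] at hb hl hll
  -- increments of `g₁` are bounded by `2 C min (1, ‖u‖)`
  have hinc : ∀ x u : Rd d, ‖gR 1 (x + u) - gR 1 x‖ ≤ 2 * C * min 1 ‖u‖ := fun x u => by
    have h1 := norm_sub_le (gR 1 (x + u)) (gR 1 x)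
    have h2 := hl (x + u) x
    rw [add_sub_cancel_left] at h2
    rw [mul_min_of_nonneg _ _ (by positivity)]
    refine le_min (by linarith [hb (x + u), hb x]) ?_
    nlinarith [norm_nonneg u, mul_nonneg hC (norm_nonneg u)]
  have hmin : ∀ u : Rd d, min 1 ‖u‖ * min 1 ‖u‖ ≤ min 1 (‖u‖ ^ 2) := fun u =>
    min_one_sq_bound (by positivity) (by positivity) ⟨min_le_left _ _, min_le_left _ _⟩
      ⟨min_le_right _ _, min_le_right _ _⟩
  have hsq : ∀ x u : Rd d, ‖gR 1 (x + u) - gR 1 x‖ ^ 2 ≤ 4 * C ^ 2 * min 1 (‖u‖ ^ 2) := by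
    intro x u
    have hm : 0 ≤ min 1 ‖u‖ := by positivity
    calc _ ≤ (2 * C * min 1 ‖u‖) ^ 2 := by gcongr; exact hinc x u
      _ = 4 * C ^ 2 * (min 1 ‖u‖ * min 1 ‖u‖) := by ring
      _ ≤ _ := by gcongr; exact hmin u
  have hdiff : ∀ x u : Rd d, |‖gR 1 (x + u) - gR 1 x‖ ^ 2 - ‖gR 1 u‖ ^ 2| ≤
      8 * C ^ 2 * ‖x‖ * min 1 (‖u‖ ^ 2) := by
    intro x u
    have hm : 0 ≤ min 1 ‖u‖ := by positivity
    have hxu := hinc x u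
    have h0u := hinc 0 u
    rw [zero_add, gR_zero, sub_zero] at h0u
    -- The second difference is at most C‖u‖‖x‖. Regrouped as (g(x+u) - g(u)) - (g(x) - g(0)), it is
    -- also at most 2C‖x‖, whatever the size of u.
    have h1 : ‖(gR 1 (x + u) - gR 1 x) - gR 1 u‖ ≤ 2 * C * ‖x‖ * min 1 ‖u‖ := by
      have h2 := hll x 0 u
      rw [zero_add, gR_zero, sub_zero, sub_zero] at h2
      have h3 := norm_sub_le (gR 1 (x + u) - gR 1 u) (gR 1 x - gR 1 0)
      have h4 := hl (x + u) u
      have h5 := hl x 0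
      rw [add_sub_cancel_right] at h4
      rw [sub_zero] at h5
      rw [gR_zero, sub_zero] at h3 h5
      rw [mul_min_of_nonneg _ _ (by positivity)]
      refine le_min ?_ ?_
      · rw [sub_right_comm]; linarith
      · nlinarith [mul_nonneg (mul_nonneg hC (norm_nonneg u)) (norm_nonneg x)]
    have h2 := (abs_norm_sub_norm_le (gR 1 (x + u) - gR 1 x) (gR 1 u)).trans h1
    -- In a² - b² = (a + b)(a - b) each factor contributes one min(1, ‖u‖).
    rw [sq_sub_sq, abs_mul, abs_of_nonneg (by positivity)]
    calc _ ≤ (2 * C * min 1 ‖u‖ + 2 * C * min 1 ‖u‖) * (2 * C * ‖x‖ * min 1 ‖u‖) := by gcongr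
      _ = 8 * C ^ 2 * ‖x‖ * (min 1 ‖u‖ * min 1 ‖u‖) := by ring
      _ ≤ _ := by gcongr; exact hmin u
  refine ⟨C + 8 * C ^ 2, by positivity, fun R hR x u => ?_⟩
  have hsm : 0 ≤ min 1 (‖R⁻¹ • u‖ ^ 2) := by positivity
  have hscale : ‖gR R (x + u) - gR R x‖ ^ 2 =
      R ^ 2 * ‖gR 1 (R⁻¹ • x + R⁻¹ • u) - gR 1 (R⁻¹ • x)‖ ^ 2 := by
    rw [gR_eq_smul hR, gR_eq_smul hR x, ← smul_sub, smul_add, norm_smul, mul_pow,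
      Real.norm_of_nonneg hR.le]
  have hscale' : ∀ y : Rd d, ‖gR R y‖ = R * ‖gR 1 (R⁻¹ • y)‖ := fun y => by
    rw [gR_eq_smul hR, norm_smul, Real.norm_of_nonneg hR.le]
  refine ⟨?_, ?_, ?_⟩
  · rw [hscale']
    gcongr
    nlinarith [hb (R⁻¹ • x)]
  · rw [hscale]
    gcongr
    refine (hsq _ _).trans ?_
    gcongr
    nlinarith
  · rw [hscale, hscale', mul_pow, ← mul_sub, abs_mul, abs_of_nonneg (sq_nonneg R)]
    gcongr
    refine (hdiff _ _).trans ?_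
    gcongr
    linarith

/-- The weight exp(-‖x‖²/R²) increases with R; this keeps the denominator of the quotient away from
0. -/
theorem integral_normSq_gR_mono {d : ℕ} (μ : Measure (Rd d)) [IsProbabilityMeasure μ]
    (hmem : ∀ R, 0 < R → MemLp (gR R) 2 μ) {R : ℝ} (hR : 1 ≤ R) :
    ∫ x, ‖gR 1 x‖ ^ 2 ∂μ ≤ ∫ x, ‖gR R x‖ ^ 2 ∂μ := by
  refine integral_mono (hmem 1 one_pos).integrable_norm_pow'
    (hmem R (by linarith)).integrable_norm_pow' fun x => ?_
  simp only [gR, norm_smul, Real.norm_of_nonneg (Real.exp_pos _).le]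
  gcongr

/-- g_R vanishes only at 0, so a zero integral would concentrate μ at the origin; {0} is a proper
subspace as d ≥ 1. -/
theorem integral_normSq_gR_pos {d : ℕ} (hd : 1 ≤ d) (μ : Measure (Rd d)) [IsProbabilityMeasure μ]
    (hnd : ¬ IsDegenerateMeasure μ) {R : ℝ} (hmem : MemLp (gR R) 2 μ) :
    0 < ∫ x, ‖gR R x‖ ^ 2 ∂μ := by
  rw [integral_pos_iff_support_of_nonneg (fun x => by positivity) hmem.integrable_norm_pow']
  by_contra h0
  refine hnd ⟨0, ⊥, ?_, ?_⟩
  · have : Nonempty (Fin d) := ⟨⟨0, hd⟩⟩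
    exact bot_ne_top
  · have hsub : ({0}ᶜ : Set (Rd d)) ⊆ Function.support fun x => ‖gR R x‖ ^ 2 := fun x hx => by
      have : x ≠ 0 := hx
      simp [gR, this, Real.exp_ne_zero]
    have hz : μ ({0}ᶜ : Set (Rd d)) = 0 :=
      measure_mono_null hsub (nonpos_iff_eq_zero.1 (not_lt.1 h0))
    intro x hx
    by_contra hne
    have hx0 : x ∈ ({0}ᶜ : Set (Rd d)) := fun h => hne ⟨0, by simp, by simpa using h.symm⟩
    have hpos := (Measure.mem_support_iff_forall x).1 hx _ (isOpen_compl_singleton.mem_nhds hx0)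
    exact hpos.ne' hz

theorem memLp_gR {d : ℕ} (μ : Measure (Rd d)) [IsProbabilityMeasure μ] {R : ℝ} (hR : 0 < R) :
    MemLp (gR R) 2 μ := by
  obtain ⟨C, -, h⟩ := exists_gR_increment_bounds d
  exact MemLp.of_bound (continuous_gR R).aestronglyMeasurable (R * C)
    (ae_of_all _ fun x => (h R hR x 0).1)

theorem HasTruncatedMomentBound.integrable_increment {d : ℕ} {α C : ℝ} {ν : Measure (Rd d)}
    (h : HasTruncatedMomentBound α C ν) {R : ℝ} (hR : 0 < R) (x : Rd d) :
    Integrable (fun u => ‖gR R (x + u) - gR R x‖ ^ 2) ν := by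
  obtain ⟨K, hK, hb⟩ := exists_gR_increment_bounds d
  have := continuous_gR (d := d) R
  refine Integrable.mono' (((h R⁻¹ (inv_pos.2 hR)).1.const_mul K).const_mul (R ^ 2))
    (Continuous.aestronglyMeasurable (by fun_prop)) (ae_of_all _ fun u => ?_)
  rw [Real.norm_of_nonneg (by positivity)]
  exact (hb R hR x u).2.1

theorem HasTruncatedMomentBound.integrable_integral_increment {d : ℕ} {α C : ℝ}
    {μ ν : Measure (Rd d)} [IsProbabilityMeasure μ] [SFinite ν]
    (h : HasTruncatedMomentBound α C ν) {R : ℝ} (hR : 0 < R) :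
    Integrable (fun x => ∫ u, ‖gR R (x + u) - gR R x‖ ^ 2 ∂ν) μ := by
  obtain ⟨K, hK, hb⟩ := exists_gR_increment_bounds d
  have := continuous_gR (d := d) R
  have hm : StronglyMeasurable fun p : Rd d × Rd d => ‖gR R (p.1 + p.2) - gR R p.1‖ ^ 2 :=
    Continuous.stronglyMeasurable (by fun_prop)
  refine Integrable.of_bound hm.integral_prod_right.aestronglyMeasurable
    (∫ u, R ^ 2 * (K * min 1 (‖R⁻¹ • u‖ ^ 2)) ∂ν) (ae_of_all _ fun x => ?_)
  rw [Real.norm_of_nonneg (integral_nonneg fun u => by positivity)]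
  exact integral_mono (h.integrable_increment hR x)
    (((h R⁻¹ (inv_pos.2 hR)).1.const_mul K).const_mul (R ^ 2)) fun u => (hb R hR x u).2.1

/-- The energy of `g_R` is close to `∫ ‖g_R‖² dν`. -/
theorem HasTruncatedMomentBound.exists_abs_energyForm_sub_le {d : ℕ} {α C : ℝ}
    {μ ν : Measure (Rd d)} [IsProbabilityMeasure μ] [SFinite ν]
    (h : HasTruncatedMomentBound α C ν) (hμ : Integrable (fun x => ‖x‖) μ) :
    ∃ K : ℝ, ∀ R : ℝ, 0 < R →
      |energyForm ν μ (gR R) (gR R) - ∫ u, ‖gR R u‖ ^ 2 ∂ν| ≤ K * (R ^ 2 * R⁻¹ * R⁻¹ ^ α) := by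
  obtain ⟨K, hK, hb⟩ := exists_gR_increment_bounds d
  refine ⟨K * C * ∫ x, ‖x‖ ∂μ, fun R hR => ?_⟩
  have hR' := inv_pos.2 hR
  obtain ⟨hi, hle⟩ := h R⁻¹ hR'
  have h0 : Integrable (fun u => ‖gR R u‖ ^ 2) ν := by
    simpa only [zero_add, gR_zero, sub_zero] using h.integrable_increment hR 0
  have hE : energyForm ν μ (gR R) (gR R) = ∫ x, ∫ u, ‖gR R (x + u) - gR R x‖ ^ 2 ∂ν ∂μ := by
    simp only [energyForm, real_inner_self_eq_norm_sq]
  have hconst : ∫ u, ‖gR R u‖ ^ 2 ∂ν = ∫ _x : Rd d, (∫ u, ‖gR R u‖ ^ 2 ∂ν) ∂μ := by simp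
  rw [hE, hconst, ← integral_sub (h.integrable_integral_increment hR) (integrable_const _)]
  -- The bound is linear in ‖x‖, so the first moment of μ suffices to integrate it.
  have hpt : ∀ x : Rd d, ‖(∫ u, ‖gR R (x + u) - gR R x‖ ^ 2 ∂ν) - ∫ u, ‖gR R u‖ ^ 2 ∂ν‖ ≤
      ‖x‖ * (K * C * (R ^ 2 * R⁻¹ * R⁻¹ ^ α)) := by
    intro x
    rw [← integral_sub (h.integrable_increment hR x) h0]
    have := norm_integral_le_of_norm_le ((hi.const_mul (K * ‖R⁻¹ • x‖)).const_mul (R ^ 2))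
      (f := fun u => ‖gR R (x + u) - gR R x‖ ^ 2 - ‖gR R u‖ ^ 2)
      (ae_of_all _ fun u => (hb R hR x u).2.2)
    refine this.trans ?_
    rw [integral_const_mul, integral_const_mul, norm_smul, Real.norm_of_nonneg hR'.le]
    calc _ ≤ R ^ 2 * (K * (R⁻¹ * ‖x‖) * (C * R⁻¹ ^ α)) := by gcongr
      _ = _ := by ring
  have := norm_integral_le_of_norm_le (hμ.mul_const _) (ae_of_all _ hpt)
  rw [integral_mul_const, Real.norm_eq_abs] at this
  refine this.trans (le_of_eq ?_)
  ring

/-! ### Passage to the limit -/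

theorem tendsto_sq_mul_inv_rpow {s : ℝ} (hs : 2 < s) :
    Tendsto (fun R : ℝ => R ^ 2 * R⁻¹ ^ s) atTop (𝓝 0) := by
  refine (tendsto_rpow_neg_atTop (show 0 < s - 2 by linarith)).congr' ?_
  filter_upwards [eventually_gt_atTop 0] with R hR
  rw [Real.inv_rpow hR.le, ← Real.rpow_neg hR.le, ← Real.rpow_natCast, ← Real.rpow_add hR]
  congr 1
  push_cast; ring

theorem mainTheorem9 (d : ℕ) (hd : 1 ≤ d) (α : ℝ) (hα₁ : 1 < α) (hα₂ : α < 2)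
    (μ : Measure (Rd d)) [IsProbabilityMeasure μ]
    (hstable : IsAlphaStable α μ) (hsymm : IsSymmetricMeasure μ) (hnd : ¬ IsDegenerateMeasure μ)
    (ν : Measure (Rd d)) (hν : IsLevyMeasureOf ν μ) :
    (∀ R : ℝ, 0 < R →
      MemLp (gR R) 2 μ ∧
      (∀ x : Rd d, Integrable (fun u => ‖gR R (x + u) - gR R x‖ ^ 2) ν) ∧
      Integrable (fun x => ∫ u, ‖gR R (x + u) - gR R x‖ ^ 2 ∂ν) μ) ∧
    Tendsto (fun R : ℝ => energyForm ν μ (gR R) (gR R) - ∫ x, ‖gR R x‖ ^ 2 ∂μ) atTop (𝓝 0) ∧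
    Tendsto (fun R : ℝ => energyForm ν μ (gR R) (gR R) / ∫ x, ‖gR R x‖ ^ 2 ∂μ) atTop (𝓝 1) := by
  obtain ⟨b, hb⟩ := hν
  have hsf : SFinite ν := hb.1.sFinite
  have hcont := hb.continuous_levySymbol
  have hcos := hb.integral_cos hsymm
  have hom : ∀ r : ℝ, 0 < r → ∀ ξ, levySymbol ν (r • ξ) = r ^ α * levySymbol ν ξ :=
    fun r hr ξ => hstable.levySymbol_smul (by linarith) ⟨b, hb⟩ hr ξ
  obtain ⟨C, hC, hmμ, hmν⟩ := exists_hasTruncatedMomentBound hb.1 hcont hcos hom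
  have hmem : ∀ R : ℝ, 0 < R → MemLp (gR R) 2 μ := fun R hR => memLp_gR μ hR
  obtain ⟨K, hK⟩ := hmν.exists_abs_energyForm_sub_le (hmμ.integrable_norm hα₁)
  obtain ⟨f, hf⟩ := exists_schwartz_normSq_gR_one d
  obtain ⟨K', -, hK'⟩ := exists_scaling_bounds hb.1 hcont hcos hom f
    (fun x => by simp only [hf, gR, norm_neg, smul_neg])
  have hnorm : ∀ R : ℝ, 0 < R →
      |∫ x, ‖gR R x‖ ^ 2 ∂μ - ∫ u, ‖gR R u‖ ^ 2 ∂ν| ≤ K' * (R ^ 2 * (R⁻¹ ^ α) ^ 2) := by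
    intro R hR
    have h1 := (hK' R⁻¹ (inv_pos.2 hR)).2.2.2
    have hsc : ∀ x : Rd d, ‖gR R x‖ ^ 2 = R ^ 2 * ‖gR 1 (R⁻¹ • x)‖ ^ 2 := fun x => by
      rw [gR_eq_smul hR, norm_smul, mul_pow, Real.norm_of_nonneg hR.le]
    simp only [hf, gR_zero, norm_zero, ne_eq, OfNat.ofNat_ne_zero, not_false_eq_true, zero_pow,
      sub_zero] at h1
    simp only [hsc, integral_const_mul]
    rw [← mul_sub, abs_mul, abs_of_nonneg (sq_nonneg R)]
    calc _ ≤ R ^ 2 * (K' * (R⁻¹ ^ α) ^ 2) := mul_le_mul_of_nonneg_left h1 (sq_nonneg R)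
      _ = _ := by ring
  have hlim : Tendsto (fun R : ℝ => energyForm ν μ (gR R) (gR R) - ∫ x, ‖gR R x‖ ^ 2 ∂μ)
      atTop (𝓝 0) := by
    -- The exponents 1 + α (energy) and 2α (norm) both exceed 2 because α > 1.
    have hz := ((tendsto_sq_mul_inv_rpow (s := 1 + α) (by linarith)).const_mul K).add
      ((tendsto_sq_mul_inv_rpow (s := α * 2) (by linarith)).const_mul K')
    rw [mul_zero, mul_zero, add_zero] at hz
    refine squeeze_zero_norm' ?_ hz
    filter_upwards [eventually_gt_atTop 0] with R hR
    have hR' := inv_pos.2 hR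
    have h1 := hK R hR
    have h2 := hnorm R hR
    rw [mul_assoc, ← Real.rpow_one_add' hR'.le (by linarith)] at h1
    rw [← Real.rpow_mul_natCast hR'.le] at h2
    rw [Real.norm_eq_abs]
    refine (abs_sub_le _ (∫ u, ‖gR R u‖ ^ 2 ∂ν) _).trans (add_le_add h1 ?_)
    rw [abs_sub_comm]
    exact_mod_cast h2
  refine ⟨fun R hR => ⟨hmem R hR, hmν.integrable_increment hR,
    hmν.integrable_integral_increment hR⟩, hlim, ?_⟩
  have hpos := integral_normSq_gR_pos hd μ hnd (hmem 1 one_pos)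
  have hrat : Tendsto (fun R : ℝ => (energyForm ν μ (gR R) (gR R) - ∫ x, ‖gR R x‖ ^ 2 ∂μ) /
      ∫ x, ‖gR R x‖ ^ 2 ∂μ) atTop (𝓝 0) := by
    -- For R ≥ 1 the denominator is at least its value at R = 1, which is positive.
    have hz := hlim.norm.div_const (∫ x, ‖gR 1 x‖ ^ 2 ∂μ)
    rw [norm_zero, zero_div] at hz
    refine squeeze_zero_norm' ?_ hz
    filter_upwards [eventually_ge_atTop 1] with R hR
    have hmono := integral_normSq_gR_mono μ hmem hR
    rw [norm_div, Real.norm_of_nonneg (hpos.le.trans hmono)]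
    gcongr
  have h1 := hrat.add_const 1
  rw [zero_add] at h1
  refine h1.congr' ?_
  filter_upwards [eventually_ge_atTop 1] with R hR
  have := (hpos.trans_le (integral_normSq_gR_mono μ hmem hR)).ne'
  field_simp
  ring
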